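/- Let $R$ be a commutative ring. A square matrix $G$ over $R$ is called alternating if $G^t=-G$ and its diagonal entries are $0$ (the second condition follows from the first if $2\in R^\times$). Let $\psi_2=\begin{pmatrix}0&1\\-1&0\end{pmatrix}$, write $\bot$ for the block diagonal sum of matrices, and let $\psi_{2r}=\psi_2\bot\cdots\bot\psi_2$ ($r$ summands). Let $E_n(R)\subset GL_n(R)$ be the subgroup generated by the elementary matrices. Let $S(R)$ be the union over all $n\ge 0$ of the sets of invertible alternating matrices of size $2n$ over $R$ with Pfaffian $1$. For $G,G'\in S(R)$ of sizes $2n$ and $2m$, put $G\sim G'$ if there are $t\in\mathbb N$ and $E\in E_{2(m+n+t)}(R)$ with $$G\bot\psi_{2(m+t)}=E^t\,(G'\bot\psi_{2(n+t)})\,E.$$ The elementary symplectic Witt group $W_E(R)=S(R)/\!\sim$ is an abelian group (written additively) with operation induced by $\bot$ and neutral element the class of $\psi_2$. For a unimodular row $(a,b,c)$ over $R$ and any $(a',b',c')\in R^3$ with $aa'+bb'+cc'=1$, let $V(a,b,c)\in W_E(R)$ be the class of $$\begin{pmatrix}0&-a&-b&-c\\ a&0&-c'&b'\\ b&c'&0&-a'\\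 c&-b'&a'&0\end{pmatrix}.$$ **Lemma.** Suppose that $-1$ is a square in $R$, and let $(a,b,c)$ be a unimodular row over $R$. Then $(a^2,b,c)$ is unimodular and $$V(a^2,b,c)=2\,V(a,b,c)\quad\text{in } W_E(R),$$ whichever choices of $(a',b',c')$ are made for the rows $(a,b,c)$ and $(a^2,b,c)$. -/

import Mathlib

namespace SympWitt

open Matrix

set_option linter.unusedSectionVars false

section Definitions

/-- The group `E_ι(R)` generated by the elementary matrices `1 + c e_{ij}`, `i ≠ j`. It is given as
a submonoid of the matrix ring, since the inverse of `1 + c e_{ij}` is `1 + (-c) e_{ij}`. -/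
def elementary (ι : Type) [Fintype ι] [DecidableEq ι] (R : Type*) [CommRing R] :
    Submonoid (Matrix ι ι R) :=
  Submonoid.closure {E | ∃ i j : ι, i ≠ j ∧ ∃ c : R, E = transvection i j c}

/-- The index set of matrices of size `2n`. The pair `(k, j)` stands for the row (or column) with
number `2k + j`, counted from `0`, and the pairs are ordered lexicographically. -/
abbrev Idx (n : ℕ) : Type := Fin n × Fin 2

variable {R : Type*} [CommRing R]

/-- The orthogonal sum of copies of `ψ₂ = (0, 1; -1, 0)`, one for each element of `κ`. For
`κ = Fin n` it is the standard matrix `ψ_{2n}`. -/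
def psi (κ : Type) [DecidableEq κ] (R : Type*) [CommRing R] : Matrix (κ × Fin 2) (κ × Fin 2) R :=
  Matrix.kroneckerMap (· * ·) (1 : Matrix κ κ R) !![0, 1; -1, 0]

/-- Pulling a matrix back along a map between the indices of the pairs of basis vectors. -/
def rx {κ l : Type} (f : κ → l) (A : Matrix (l × Fin 2) (l × Fin 2) R) :
    Matrix (κ × Fin 2) (κ × Fin 2) R :=
  A.submatrix (Prod.map f id) (Prod.map f id)

/-- The block diagonal sum of two matrices, with rows and columns indexed by a disjoint union. -/
def osum {κ l : Type} (G : Matrix (κ × Fin 2) (κ × Fin 2) R)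
    (H : Matrix (l × Fin 2) (l × Fin 2) R) : Matrix ((κ ⊕ l) × Fin 2) ((κ ⊕ l) × Fin 2) R :=
  (Matrix.fromBlocks G 0 0 H).submatrix (Equiv.sumProdDistrib κ l (Fin 2))
    (Equiv.sumProdDistrib κ l (Fin 2))

/-- The block diagonal sum `G ⊥ H` of a matrix of size `2m` and a matrix of size `2n`, as a matrix
of size `2(m + n)`: the rows and columns of `G` come first. -/
def perp {m n : ℕ} (G : Matrix (Idx m) (Idx m) R) (H : Matrix (Idx n) (Idx n) R) :
    Matrix (Idx (m + n)) (Idx (m + n)) R :=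
  rx finSumFinEquiv.symm (osum G H)

/-- The relation `G ∼ G'` between matrices of sizes `2n` and `2m`: for some `t` and some
elementary matrix `E` of size `2(m + n + t)`, `G ⊥ ψ_{2(m+t)} = Eᵀ (G' ⊥ ψ_{2(n+t)}) E`. The map
`rx (Fin.cast _)` only identifies the sizes `n + (m + t)` and `m + (n + t)`. -/
def StableCongr {n m : ℕ} (G : Matrix (Idx n) (Idx n) R) (G' : Matrix (Idx m) (Idx m) R) : Prop :=
  ∃ t : ℕ, ∃ E ∈ elementary (Idx (n + (m + t))) R,
    perp G (psi (Fin (m + t)) R) =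
      Eᵀ * rx (Fin.cast (Nat.add_left_comm n m t)) (perp G' (psi (Fin (n + t)) R)) * E

/-- The Pfaffian of an alternating matrix, by expansion along the first row (and `0` in odd
size). -/
def pf : (k : ℕ) → Matrix (Fin k) (Fin k) R → R
  | 0, _ => 1
  | 1, _ => 0
  | k + 2, A => ∑ j : Fin (k + 1), (-1) ^ (j : ℕ) * A 0 j.succ *
      pf k (A.submatrix (Fin.succ ∘ j.succAbove) (Fin.succ ∘ j.succAbove))

/-- The Pfaffian of an alternating matrix of size `2n`. -/
def pfaffian {n : ℕ} (G : Matrix (Idx n) (Idx n) R) : R :=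
  pf (n * 2) (G.submatrix finProdFinEquiv.symm finProdFinEquiv.symm)

/-- Alternating matrices: antisymmetric with zero diagonal. The condition on the diagonal is
automatic if `2` is invertible, see `isAlternating_iff`. -/
def IsAlternating {ι : Type} (G : Matrix ι ι R) : Prop :=
  Gᵀ = -G ∧ ∀ i, G i i = 0

theorem isAlternating_iff {ι : Type} (h2 : IsUnit (2 : R)) (G : Matrix ι ι R) :
    IsAlternating G ↔ Gᵀ = -G := by
  refine ⟨fun h => h.1, fun h => ⟨h, fun i => ?_⟩⟩
  have h1 : G i i = -G i i := congrFun (congrFun h i) i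
  refine h2.mul_left_cancel ?_
  linear_combination h1

/-- The set `S(R)`, the union over all `n` of the sets of invertible alternating matrices of size
`2n` with Pfaffian `1`. -/
structure AltForm (R : Type*) [CommRing R] where
  /-- half of the size -/
  n : ℕ
  /-- the matrix -/
  mat : Matrix (Idx n) (Idx n) R
  alt : IsAlternating mat
  isUnit : IsUnit mat
  pfaffian_eq : pfaffian mat = 1

/-- The matrix `σ_n`, the orthogonal sum of `n` copies of `(0, 1; 1, 0)`. -/
def sigma (n : ℕ) (R : Type*) [CommRing R] : Matrix (Idx n) (Idx n) R :=
  Matrix.kroneckerMap (· * ·) (1 : Matrix (Fin n) (Fin n) R) !![0, 1; 1, 0]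

end Definitions

section Pfaffian
variable {R : Type*} [CommRing R]

/-- Contraction of a wedge product of vectors. -/
theorem contractLeft_wedge {M : Type*} [AddCommGroup M] [Module R M] (d : Module.Dual R M) :
    ∀ (k : ℕ) (v : Fin (k + 1) → M),
      CliffordAlgebra.contractLeft (Q := (0 : QuadraticForm R M)) d
          (ExteriorAlgebra.ιMulti R (k + 1) v) =
        ∑ j : Fin (k + 1), ((-1) ^ (j : ℕ) * d (v j)) •
          ExteriorAlgebra.ιMulti R k (v ∘ j.succAbove) := by
  intro k
  induction k with
  | zero =>
    intro v
    rw [ExteriorAlgebra.ιMulti_succ_apply]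
    erw [CliffordAlgebra.contractLeft_ι_mul]
    simp
  | succ k ih =>
    intro v
    conv_rhs => rw [Fin.sum_univ_succ]
    rw [ExteriorAlgebra.ιMulti_succ_apply]
    erw [CliffordAlgebra.contractLeft_ι_mul, ih]
    have h0 : v ∘ Fin.succAbove 0 = Matrix.vecTail v := rfl
    rw [h0]
    simp only [Fin.val_zero, pow_zero, one_mul, Fin.val_succ, sub_eq_add_neg]
    congr 1
    rw [Finset.mul_sum, ← Finset.sum_neg_distrib]
    refine Finset.sum_congr rfl fun j _ => ?_
    rw [ExteriorAlgebra.ιMulti_succ_apply]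
    have h1 : Matrix.vecTail (v ∘ j.succ.succAbove) = Matrix.vecTail v ∘ j.succAbove := by
      funext i; simp [Matrix.vecTail]
    rw [h1, mul_smul_comm, pow_succ]
    simp [Matrix.vecTail]

/-- The Pfaffian of a Gram matrix is the scalar part of a deformed wedge product; in particular
it is an alternating function of the vectors. -/
theorem pf_gram {M : Type*} [AddCommGroup M] [Module R M] (B : LinearMap.BilinForm R M)
    (h : (-B).toQuadraticMap = (0 : QuadraticForm R M) - 0) :
    ∀ (k : ℕ) (v : Fin k → M), pf k (Matrix.of fun i j => B (v i) (v j)) =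
      ExteriorAlgebra.algebraMapInv
        (CliffordAlgebra.changeForm h (ExteriorAlgebra.ιMulti R k v)) := by
  intro k
  induction k using Nat.twoStepInduction with
  | zero =>
    intro v
    rw [ExteriorAlgebra.ιMulti_zero_apply]
    erw [CliffordAlgebra.changeForm_one]
    simp [pf]
  | one =>
    intro v
    rw [ExteriorAlgebra.ιMulti_succ_apply, ExteriorAlgebra.ιMulti_zero_apply, mul_one]
    erw [CliffordAlgebra.changeForm_ι]
    simp only [pf]
    symm
    change ExteriorAlgebra.algebraMapInv (ExteriorAlgebra.ι R (v 0)) = 0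
    simp [ExteriorAlgebra.algebraMapInv]
  | more k ih _ =>
    intro v
    rw [ExteriorAlgebra.ιMulti_succ_apply]
    erw [CliffordAlgebra.changeForm_ι_mul, ← CliffordAlgebra.changeForm_contractLeft,
      contractLeft_wedge]
    have hz : ∀ x, ExteriorAlgebra.algebraMapInv (ExteriorAlgebra.ι R (v 0) * x) = (0 : R) := by
      intro x
      rw [map_mul]
      simp [ExteriorAlgebra.algebraMapInv]
    erw [map_sub, hz]
    rw [pf, zero_sub, map_sum, map_sum, ← Finset.sum_neg_distrib]
    refine Finset.sum_congr rfl fun j _ => ?_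
    have := ih (Matrix.vecTail v ∘ j.succAbove)
    erw [map_smul, map_smul]
    erw [← this]
    simp [Matrix.vecTail]
    rfl

theorem pf_congr {k : ℕ} (A E : Matrix (Fin k) (Fin k) R) (h1 : Aᵀ = -A)
    (h2 : ∀ i, A i i = 0) : pf k (Eᵀ * A * E) = E.det * pf k A := by
  let B : LinearMap.BilinForm R (Fin k → R) := Matrix.toBilin' A
  have hB : (-B).toQuadraticMap = (0 : QuadraticForm R (Fin k → R)) - 0 := by
    ext x
    simp only [LinearMap.BilinMap.toQuadraticMap_apply, LinearMap.neg_apply, sub_zero,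
      _root_.zero_apply, neg_eq_zero, B, Matrix.toBilin'_apply]
    rw [← Finset.sum_product']
    refine Finset.sum_involution (fun p _ => (p.2, p.1)) ?_ ?_ ?_ ?_
    · rintro ⟨i, j⟩ _
      have : A j i = - A i j := by
        have := congrFun (congrFun h1 i) j
        simpa using this
      simp only [this]; ring
    · rintro ⟨i, j⟩ _ hne heq
      apply hne
      simp only [Prod.mk.injEq] at heq
      obtain ⟨rfl, -⟩ := heq
      simp [h2]
    · simp
    · simp
  let f : (Fin k → R) [⋀^Fin k]→ₗ[R] R :=
    ((ExteriorAlgebra.algebraMapInv (R := R) (M := Fin k → R)).toLinearMap.comp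
      (CliffordAlgebra.changeForm hB)).compAlternatingMap (ExteriorAlgebra.ιMulti R k)
  have hf : ∀ v : Fin k → (Fin k → R), f v = pf k (Matrix.of fun i j => B (v i) (v j)) :=
    fun v => (pf_gram B hB k v).symm
  let w : Fin k → Fin k → R := fun i j => E j i
  have hdet : f w = f (Pi.basisFun R (Fin k)) * (Pi.basisFun R (Fin k)).det w :=
    DFunLike.congr_fun (f.eq_smul_basis_det (Pi.basisFun R (Fin k))) w
  rw [Pi.basisFun_det_apply, hf, hf] at hdet
  have e1 : (Matrix.of fun i j => B (w i) (w j)) = Eᵀ * A * E := by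
    ext i j
    rw [Matrix.mul_assoc]
    simp only [B, w, Matrix.of_apply, Matrix.toBilin'_apply', Matrix.mul_apply,
      dotProduct, Matrix.mulVec, Matrix.transpose_apply]
  have e2 : (Matrix.of fun i j => B (Pi.basisFun R (Fin k) i) (Pi.basisFun R (Fin k) j)) = A := by
    ext i j
    simp [B]
  rw [e1, e2] at hdet
  rw [hdet]
  change _ * Matrix.det Eᵀ = _
  rw [Matrix.det_transpose, mul_comm]

theorem pf_cast {k l : ℕ} (h : k = l) (A : Matrix (Fin l) (Fin l) R) :
    pf k (A.submatrix (Fin.cast h) (Fin.cast h)) = pf l A := by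
  subst h; rfl

/-- The Pfaffian is multiplicative on block sums. -/
theorem pf_block : ∀ (k l N : ℕ) (h : N = k + l) (M : Matrix (Fin N) (Fin N) R),
    (∀ i j : Fin N, i.val < k → k ≤ j.val → M i j = 0) →
    pf N M = pf k (M.submatrix (fun i => Fin.cast h.symm (Fin.castAdd l i))
        (fun i => Fin.cast h.symm (Fin.castAdd l i))) *
      pf l (M.submatrix (fun i => Fin.cast h.symm (Fin.natAdd k i))
        (fun i => Fin.cast h.symm (Fin.natAdd k i))) := by
  intro k
  induction k using Nat.twoStepInduction with
  | zero =>
    intro l N h M _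
    obtain rfl : N = l := by omega
    simp only [pf, one_mul]
    congr 1
    ext i j
    simp only [Matrix.submatrix_apply]
    congr 1 <;> ext <;> simp
  | one =>
    intro l N h M h0
    obtain rfl : N = l + 1 := by omega
    simp only [pf, zero_mul]
    match l with
    | 0 => simp [pf]
    | l + 1 =>
      simp only [pf]
      refine Finset.sum_eq_zero fun j _ => ?_
      rw [h0 0 j.succ (by simp) (by simp)]
      simp
  | more k ih _ =>
    intro l N h M h0
    obtain rfl : N = (k + l) + 2 := by omega
    rw [pf, pf, Finset.sum_mul]
    have hs : k + l + 1 = (k + 1) + l := by omega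
    rw [← (finCongr hs).symm.sum_comp, Fin.sum_univ_add]
    have hz : ∑ i : Fin l, (fun j : Fin (k + l + 1) => (-1) ^ (j : ℕ) * M 0 j.succ *
      pf (k + l) (M.submatrix (Fin.succ ∘ j.succAbove) (Fin.succ ∘ j.succAbove)))
        ((finCongr hs).symm (Fin.natAdd (k + 1) i)) = 0 := by
      refine Finset.sum_eq_zero fun i _ => ?_
      simp only []
      rw [h0 0 _ (by simp) (by simp)]
      simp
    erw [hz]
    rw [add_zero]
    refine Finset.sum_congr rfl fun j _ => ?_
    rw [ih l (k + l) rfl]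
    · simp only [Matrix.submatrix_submatrix, ← mul_assoc]
      congr 1
      · congr 1
        congr 1
        ext a b
        simp only [Matrix.submatrix_apply, Function.comp]
        congr 1 <;> ext <;> simp [Fin.succAbove, Fin.lt_def] <;> split_ifs <;> simp
      · congr 1
        ext a b
        simp only [Matrix.submatrix_apply, Function.comp]
        congr 1 <;> ext <;> simp [Fin.succAbove, Fin.lt_def] <;> split_ifs <;> simp <;> omega
    · intro a b ha hb
      simp only [Matrix.submatrix_apply, Function.comp]
      apply h0
      · simp [Fin.succAbove, Fin.lt_def]; split_ifs <;> simp <;> omega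
      · simp [Fin.succAbove, Fin.lt_def]; split_ifs <;> simp <;> omega

end Pfaffian

section Elementary
variable {R : Type*} [CommRing R]
variable {ι κ : Type} [Fintype ι] [DecidableEq ι] [Fintype κ] [DecidableEq κ]

theorem transvection_mem {i j : ι} (h : i ≠ j) (c : R) : transvection i j c ∈ elementary ι R :=
  Submonoid.subset_closure ⟨i, j, h, c, rfl⟩

theorem elementary_det {E : Matrix ι ι R} (hE : E ∈ elementary ι R) : E.det = 1 := by
  induction hE using Submonoid.closure_induction with
  | mem x hx => obtain ⟨i, j, h, c, rfl⟩ := hx; exact det_transvection_of_ne i j h c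
  | one => simp
  | mul x y _ _ hx hy => rw [det_mul, hx, hy, one_mul]

theorem elementary_inv {E : Matrix ι ι R} (hE : E ∈ elementary ι R) :
    ∃ F ∈ elementary ι R, E * F = 1 := by
  induction hE using Submonoid.closure_induction with
  | mem x hx =>
    obtain ⟨i, j, h, c, rfl⟩ := hx
    exact ⟨_, transvection_mem h (-c), by simp [transvection_mul_transvection_same _ _ h]⟩
  | one => exact ⟨1, one_mem _, by simp⟩
  | mul x y _ _ hx hy =>
    obtain ⟨F, hF, h1⟩ := hx
    obtain ⟨K, hK, h2⟩ := hy
    exact ⟨K * F, mul_mem hK hF, by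
      rw [mul_assoc, ← mul_assoc y, h2, one_mul, h1]⟩

theorem elementary_submatrix (e : κ ≃ ι) {E : Matrix ι ι R} (hE : E ∈ elementary ι R) :
    E.submatrix e e ∈ elementary κ R := by
  induction hE using Submonoid.closure_induction with
  | mem x hx =>
    obtain ⟨i, j, h, c, rfl⟩ := hx
    have : (transvection i j c).submatrix e e = transvection (e.symm i) (e.symm j) c := by
      ext a b
      simp [transvection, Matrix.one_apply, Matrix.single_apply, Equiv.symm_apply_eq]
    rw [this]
    exact transvection_mem (by simpa using h) c
  | one => simp [one_mem]
  | mul x y _ _ hx hy =>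
    rw [← Matrix.submatrix_mul_equiv x y e e e]
    exact mul_mem hx hy

theorem elementary_sumInl {E : Matrix ι ι R} (hE : E ∈ elementary ι R) :
    fromBlocks E 0 0 (1 : Matrix κ κ R) ∈ elementary (ι ⊕ κ) R := by
  induction hE using Submonoid.closure_induction with
  | mem x hx =>
    obtain ⟨i, j, h, c, rfl⟩ := hx
    have := TransvectionStruct.toMatrix_sumInl (p := κ) ⟨i, j, h, c⟩
    simp only [TransvectionStruct.toMatrix_mk] at this
    rw [← this]
    exact transvection_mem (TransvectionStruct.sumInl κ ⟨i, j, h, c⟩).hij c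
  | one => simp [one_mem]
  | mul x y _ _ hx hy =>
    have := mul_mem hx hy
    simpa [fromBlocks_multiply] using this

theorem elementary_upper (X : Matrix ι κ R) :
    fromBlocks 1 X 0 1 ∈ elementary (ι ⊕ κ) R := by
  induction X using Matrix.induction_on' with
  | h_zero => simp [one_mem]
  | h_add p q hp hq =>
    have := mul_mem hp hq
    simpa [fromBlocks_multiply, add_comm] using this
  | h_std_basis i j x =>
    have : fromBlocks 1 (Matrix.single i j x) 0 1 =
        transvection (Sum.inl i : ι ⊕ κ) (Sum.inr j) x := by
      ext (a | a) (b | b) <;>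
        simp [transvection, Matrix.single_apply, Matrix.one_apply]
    rw [this]
    exact transvection_mem (by simp) x

theorem elementary_lower (X : Matrix κ ι R) :
    fromBlocks 1 0 X 1 ∈ elementary (ι ⊕ κ) R := by
  have := elementary_submatrix (Equiv.sumComm ι κ) (elementary_upper X)
  convert this using 1
  ext (a | a) (b | b) <;> simp

/-- Congruence by elementary matrices. -/
def ElemCongr (A B : Matrix ι ι R) : Prop := ∃ E ∈ elementary ι R, A = Eᵀ * B * E

theorem ElemCongr.refl (A : Matrix ι ι R) : ElemCongr A A := ⟨1, one_mem _, by simp⟩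

theorem ElemCongr.symm {A B : Matrix ι ι R} (h : ElemCongr A B) : ElemCongr B A := by
  obtain ⟨E, hE, rfl⟩ := h
  obtain ⟨F, hF, h1⟩ := elementary_inv hE
  refine ⟨F, hF, ?_⟩
  have h2 : Fᵀ * Eᵀ = 1 := by rw [← transpose_mul, h1, transpose_one]
  calc B = (Fᵀ * Eᵀ) * B * (E * F) := by rw [h1, h2]; simp
    _ = _ := by simp only [mul_assoc]

theorem ElemCongr.trans {A B C : Matrix ι ι R} (h : ElemCongr A B) (h' : ElemCongr B C) :
    ElemCongr A C := by
  obtain ⟨E, hE, rfl⟩ := h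
  obtain ⟨F, hF, rfl⟩ := h'
  exact ⟨F * E, mul_mem hF hE, by simp only [transpose_mul, mul_assoc]⟩

theorem ElemCongr.submatrix (e : κ ≃ ι) {A B : Matrix ι ι R} (h : ElemCongr A B) :
    ElemCongr (A.submatrix e e) (B.submatrix e e) := by
  obtain ⟨E, hE, rfl⟩ := h
  refine ⟨_, elementary_submatrix e hE, ?_⟩
  rw [transpose_submatrix, Matrix.submatrix_mul_equiv, Matrix.submatrix_mul_equiv]

theorem ElemCongr.fromBlocks {A B : Matrix ι ι R} (h : ElemCongr A B) (C : Matrix κ κ R) :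
    ElemCongr (fromBlocks A 0 0 C) (fromBlocks B 0 0 C) := by
  obtain ⟨E, hE, rfl⟩ := h
  exact ⟨_, elementary_sumInl hE, by simp [fromBlocks_transpose, fromBlocks_multiply]⟩

theorem signedSwap_mul {a b : ι} (h : a ≠ b) (M : Matrix ι ι R) (x y : ι) :
    (transvection a b (1 : R) * transvection b a (-1) * transvection a b 1 * M : Matrix ι ι R) x y =
      if x = a then M b y else if x = b then -M a y else M x y := by
  rw [Matrix.mul_assoc, Matrix.mul_assoc]
  by_cases hx : x = a
  · subst hx
    simp [h.symm, h, transvection_mul_apply_of_ne, transvection_mul_apply_same]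
  · by_cases hy : x = b
    · subst hy
      simp [h.symm, transvection_mul_apply_of_ne, transvection_mul_apply_same]
    · simp [hx, hy, transvection_mul_apply_of_ne]

theorem signedSwap_mem {a b : ι} (h : a ≠ b) :
    transvection a b (1 : R) * transvection b a (-1) * transvection a b 1 ∈ elementary ι R :=
  mul_mem (mul_mem (transvection_mem h _) (transvection_mem h.symm _)) (transvection_mem h _)

/-- A permutation matrix which permutes pairs of basis vectors is elementary. -/
theorem pairPerm_mem (σ : Equiv.Perm κ) :
    (1 : Matrix (κ × Fin 2) (κ × Fin 2) R).submatrix (Prod.map σ id) id ∈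
      elementary (κ × Fin 2) R := by
  induction σ using Equiv.Perm.swap_induction_on with
  | one => simp [one_mem]
  | swap_mul σ i j hij ih =>
    have key : (1 : Matrix (κ × Fin 2) (κ × Fin 2) R).submatrix
        (Prod.map (Equiv.swap i j) id) id ∈ elementary (κ × Fin 2) R := by
      have h0 : ((i, 0) : κ × Fin 2) ≠ (j, 0) := by simp [hij]
      have h1 : ((i, 1) : κ × Fin 2) ≠ (j, 1) := by simp [hij]
      have h2 : ((i, 0) : κ × Fin 2) ≠ (i, 1) := by simp
      have := mul_mem (signedSwap_mem (R := R) h0) (mul_mem (signedSwap_mem (R := R) h1)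
        (mul_mem (signedSwap_mem (R := R) h2) (mul_mem (signedSwap_mem (R := R) h2)
          (one_mem _))))
      convert this using 1
      ext ⟨x, u⟩ y
      rw [signedSwap_mul h0]
      simp only [signedSwap_mul h1, signedSwap_mul h2, Matrix.submatrix_apply]
      have hji := hij.symm
      have hu : ∀ u : Fin 2, u = 0 ∨ u = 1 := by decide
      by_cases hx : x = i
      · subst hx
        rcases hu u with rfl | rfl <;> simp [hij, hji, Matrix.one_apply]
      · by_cases hx' : x = j
        · subst hx'
          rcases hu u with rfl | rfl <;> simp [hij, hji, Matrix.one_apply]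
        · simp [hx, hx', Matrix.one_apply, Equiv.swap_apply_of_ne_of_ne]
    have := mul_mem ih key
    convert this using 1
    ext x y
    rw [Matrix.mul_apply, Finset.sum_eq_single (Prod.map σ id x)]
    · simp only [Matrix.submatrix_apply, id, Matrix.one_apply, if_true, mul_ite, mul_one, mul_zero]
      rcases x with ⟨x, u⟩
      simp only [Prod.map_apply, Equiv.Perm.coe_mul, Function.comp, id]
      congr
    · intro b _ hb
      simp [Matrix.one_apply, hb.symm]
    · simp

theorem ElemCongr.pairPerm (σ : Equiv.Perm κ) (A : Matrix (κ × Fin 2) (κ × Fin 2) R) :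
    ElemCongr (A.submatrix (Prod.map σ id) (Prod.map σ id)) A := by
  refine ⟨_, pairPerm_mem σ.symm, ?_⟩
  ext ⟨x, u⟩ ⟨y, v⟩
  simp only [Matrix.mul_apply, transpose_apply, Matrix.submatrix_apply, one_apply, Prod.map, id]
  have : ∀ (k : κ × Fin 2) (z : κ) (w : Fin 2), ((σ.symm k.1, k.2) = (z, w)) ↔ k = (σ z, w) := by
    rintro ⟨k, c⟩ z w
    simp [Equiv.symm_apply_eq]
  simp [this]


theorem exists_sub_transpose {G : Matrix ι ι R} (h1 : Gᵀ = -G) (h2 : ∀ i, G i i = 0) :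
    ∃ U : Matrix ι ι R, G = U - Uᵀ := by
  let f := Fintype.equivFin ι
  refine ⟨Matrix.of fun i j => if f i < f j then G i j else 0, ?_⟩
  ext i j
  have hji : G j i = - G i j := by
    have := congrFun (congrFun h1 i) j
    simpa using this
  rcases lt_trichotomy (f i) (f j) with h | h | h
  · simp [h, h.not_gt]
  · obtain rfl := f.injective h
    simp [h2]
  · simp [h, h.not_gt, hji]

theorem inv_transpose_of_alt {G : Matrix ι ι R} (h1 : Gᵀ = -G) (h3 : IsUnit G) :
    (G⁻¹)ᵀ = -G⁻¹ := by
  have hGi : G * G⁻¹ = 1 := Matrix.mul_nonsing_inv G ((Matrix.isUnit_iff_isUnit_det G).1 h3)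
  have h : (G⁻¹)ᵀ * Gᵀ = 1 := by rw [← transpose_mul, hGi, transpose_one]
  rw [h1] at h
  calc (G⁻¹)ᵀ = -((G⁻¹)ᵀ * (-G)) * G⁻¹ := by
        rw [mul_neg, neg_neg, mul_assoc, hGi, mul_one]
    _ = -G⁻¹ := by rw [h]; simp

theorem altBlocks_congr {G s : Matrix ι ι R} (h1 : Gᵀ = -G) (h2 : ∀ i, G i i = 0)
    (h3 : IsUnit G) (hs : sᵀ = s) (hs' : s * s = 1) :
    ElemCongr (Matrix.fromBlocks G 0 0 (s * G⁻¹ * s)) (Matrix.fromBlocks 0 s (-s) 0) := by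
  have hdet : IsUnit G.det := (Matrix.isUnit_iff_isUnit_det G).1 h3
  have hGi : G * G⁻¹ = 1 := Matrix.mul_nonsing_inv G hdet
  have hiG : G⁻¹ * G = 1 := Matrix.nonsing_inv_mul G hdet
  have hit := inv_transpose_of_alt h1 h3
  obtain ⟨U, hU⟩ := exists_sub_transpose h1 h2
  have step1 : ElemCongr (Matrix.fromBlocks G s (-s) 0)
      (Matrix.fromBlocks G 0 0 (s * G⁻¹ * s)) := by
    refine ⟨_, elementary_upper (G⁻¹ * s), ?_⟩
    have e1 : s * G⁻¹ * G = s := by rw [mul_assoc, hiG, mul_one]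
    have e2 : G * (G⁻¹ * s) = s := by rw [← mul_assoc, hGi, one_mul]
    simp [fromBlocks_transpose, fromBlocks_multiply, hs, hit, e1, e2]
    simp [mul_assoc]
  have step2 : ElemCongr (Matrix.fromBlocks G s (-s) 0) (Matrix.fromBlocks 0 s (-s) 0) := by
    refine ⟨_, elementary_lower (s * U), ?_⟩
    have e1 : s * (s * U) = U := by rw [← mul_assoc, hs', one_mul]
    have e2 : Uᵀ * s * s = Uᵀ := by rw [mul_assoc, hs', mul_one]
    simp [fromBlocks_transpose, fromBlocks_multiply, hs, e1, e2]
    rw [hU]; abel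
  exact step1.symm.trans step2

end Elementary

section Sum
variable {R : Type*} [CommRing R]
variable {κ l m : Type} [Fintype κ] [DecidableEq κ]
  [Fintype l] [DecidableEq l] [Fintype m] [DecidableEq m]

theorem rx_psi (e : κ ≃ l) : rx e (psi l R) = psi κ R := by
  ext ⟨i, a⟩ ⟨j, b⟩
  simp [rx, psi, Matrix.one_apply]

theorem osum_psi : osum (psi κ R) (psi l R) = psi (κ ⊕ l) R := by
  ext ⟨i | i, a⟩ ⟨j | j, b⟩ <;> simp [osum, psi, Matrix.one_apply]

/-- Congruence by elementary matrices, up to renumbering the pairs of basis vectors. -/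
def Iso (A : Matrix (κ × Fin 2) (κ × Fin 2) R) (B : Matrix (l × Fin 2) (l × Fin 2) R) : Prop :=
  ∃ e : κ ≃ l, ElemCongr A (rx e B)

theorem ElemCongr.rx (e : κ ≃ l) {A B : Matrix (l × Fin 2) (l × Fin 2) R} (h : ElemCongr A B) :
    ElemCongr (rx e A) (rx e B) :=
  h.submatrix (e.prodCongr (Equiv.refl _))

theorem Iso.symm {A : Matrix (κ × Fin 2) (κ × Fin 2) R} {B : Matrix (l × Fin 2) (l × Fin 2) R}
    (h : Iso A B) : Iso B A := by
  obtain ⟨e, h⟩ := h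
  refine ⟨e.symm, ?_⟩
  have := (h.rx e.symm).symm
  have h2 : SympWitt.rx e.symm (SympWitt.rx e B) = B := by
    ext ⟨i, a⟩ ⟨j, b⟩; simp [SympWitt.rx]
  rwa [h2] at this

theorem Iso.trans {A : Matrix (κ × Fin 2) (κ × Fin 2) R} {B : Matrix (l × Fin 2) (l × Fin 2) R}
    {C : Matrix (m × Fin 2) (m × Fin 2) R} (h : Iso A B) (h' : Iso B C) : Iso A C := by
  obtain ⟨e, h⟩ := h
  obtain ⟨f, h'⟩ := h'
  exact ⟨e.trans f, h.trans (h'.rx e)⟩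

theorem ElemCongr.iso {A B : Matrix (κ × Fin 2) (κ × Fin 2) R} (h : ElemCongr A B) : Iso A B :=
  ⟨Equiv.refl _, h⟩

theorem Iso.refl (A : Matrix (κ × Fin 2) (κ × Fin 2) R) : Iso A A := (ElemCongr.refl A).iso

theorem Iso.of_eq {A B : Matrix (κ × Fin 2) (κ × Fin 2) R} (h : A = B) : Iso A B := h ▸ Iso.refl A

theorem Iso.rx (e : κ ≃ l) (A : Matrix (l × Fin 2) (l × Fin 2) R) : Iso (rx e A) A :=
  ⟨e, ElemCongr.refl _⟩

theorem Iso.congr {A B : Matrix (κ × Fin 2) (κ × Fin 2) R} (h : Iso A B) : ElemCongr A B := by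
  obtain ⟨e, h⟩ := h
  exact h.trans (ElemCongr.pairPerm e B)

theorem Iso.osum_left {A : Matrix (κ × Fin 2) (κ × Fin 2) R} {B : Matrix (l × Fin 2) (l × Fin 2) R}
    (h : Iso A B) (C : Matrix (m × Fin 2) (m × Fin 2) R) : Iso (osum A C) (osum B C) := by
  obtain ⟨e, h⟩ := h
  refine ⟨Equiv.sumCongr e (Equiv.refl _), ?_⟩
  have := (h.fromBlocks C).submatrix (Equiv.sumProdDistrib κ m (Fin 2))
  have e1 : SympWitt.rx (Equiv.sumCongr e (Equiv.refl m)) (osum B C) =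
      osum (SympWitt.rx e B) C := by
    ext ⟨i | i, a⟩ ⟨j | j, b⟩ <;> simp [osum, SympWitt.rx]
  rw [e1]
  exact this

theorem Iso.osum_comm (A : Matrix (κ × Fin 2) (κ × Fin 2) R) (B : Matrix (l × Fin 2) (l × Fin 2) R) :
    Iso (osum A B) (osum B A) := by
  refine ⟨Equiv.sumComm _ _, ?_⟩
  have e1 : SympWitt.rx (Equiv.sumComm κ l) (osum B A) = osum A B := by
    ext ⟨i | i, a⟩ ⟨j | j, b⟩ <;> simp [osum, SympWitt.rx]
  rw [e1]
  exact ElemCongr.refl _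

theorem Iso.osum_assoc (A : Matrix (κ × Fin 2) (κ × Fin 2) R) (B : Matrix (l × Fin 2) (l × Fin 2) R)
    (C : Matrix (m × Fin 2) (m × Fin 2) R) :
    Iso (osum (osum A B) C) (osum A (osum B C)) := by
  refine ⟨Equiv.sumAssoc _ _ _, ?_⟩
  have e1 : SympWitt.rx (Equiv.sumAssoc κ l m) (osum A (osum B C)) = osum (osum A B) C := by
    ext ⟨(i | i) | i, a⟩ ⟨(j | j) | j, b⟩ <;> simp [osum, SympWitt.rx]
  rw [e1]
  exact ElemCongr.refl _

theorem Iso.osum_right {A : Matrix (κ × Fin 2) (κ × Fin 2) R} {B : Matrix (l × Fin 2) (l × Fin 2) R}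
    (h : Iso A B) (C : Matrix (m × Fin 2) (m × Fin 2) R) : Iso (osum C A) (osum C B) :=
  (osum_comm _ _).trans ((h.osum_left C).trans (osum_comm _ _))

theorem Iso.right_comm (A : Matrix (κ × Fin 2) (κ × Fin 2) R) (B : Matrix (l × Fin 2) (l × Fin 2) R)
    (C : Matrix (m × Fin 2) (m × Fin 2) R) :
    Iso (osum (osum A B) C) (osum (osum A C) B) :=
  (osum_assoc _ _ _).trans (((osum_comm B C).osum_right A).trans (osum_assoc _ _ _).symm)

/-- Stable equivalence of forms. -/
def Stab (A : Matrix (κ × Fin 2) (κ × Fin 2) R) (B : Matrix (l × Fin 2) (l × Fin 2) R) : Prop :=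
  ∃ p q : ℕ, Iso (osum A (psi (Fin p) R)) (osum B (psi (Fin q) R))

theorem Iso.stab {A : Matrix (κ × Fin 2) (κ × Fin 2) R} {B : Matrix (l × Fin 2) (l × Fin 2) R}
    (h : Iso A B) : Stab A B := ⟨0, 0, h.osum_left _⟩

theorem Stab.symm {A : Matrix (κ × Fin 2) (κ × Fin 2) R} {B : Matrix (l × Fin 2) (l × Fin 2) R}
    (h : Stab A B) : Stab B A := by
  obtain ⟨p, q, h⟩ := h
  exact ⟨q, p, h.symm⟩

theorem osum_psi_psi (A : Matrix (κ × Fin 2) (κ × Fin 2) R) (p q : ℕ) :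
    Iso (osum A (psi (Fin (p + q)) R)) (osum (osum A (psi (Fin p) R)) (psi (Fin q) R)) := by
  refine Iso.trans (Iso.osum_right ?_ A) (Iso.osum_assoc _ _ _).symm
  rw [osum_psi, ← rx_psi finSumFinEquiv]
  exact (Iso.rx finSumFinEquiv (psi (Fin (p + q)) R)).symm

theorem Stab.trans {A : Matrix (κ × Fin 2) (κ × Fin 2) R} {B : Matrix (l × Fin 2) (l × Fin 2) R}
    {C : Matrix (m × Fin 2) (m × Fin 2) R} (h : Stab A B) (h' : Stab B C) : Stab A C := by
  obtain ⟨p, q, h⟩ := h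
  obtain ⟨r, s, h'⟩ := h'
  refine ⟨p + r, s + q, ?_⟩
  refine (osum_psi_psi A p r).trans ((h.osum_left _).trans ?_)
  refine (Iso.right_comm _ _ _).trans ((h'.osum_left _).trans ?_)
  exact (osum_psi_psi C s q).symm

theorem Stab.osum_left {A : Matrix (κ × Fin 2) (κ × Fin 2) R}
    {B : Matrix (l × Fin 2) (l × Fin 2) R}
    (h : Stab A B) (C : Matrix (m × Fin 2) (m × Fin 2) R) : Stab (osum A C) (osum B C) := by
  obtain ⟨p, q, h⟩ := h
  exact ⟨p, q, (Iso.right_comm _ _ _).trans ((h.osum_left C).trans (Iso.right_comm _ _ _))⟩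

theorem Stab.osum_psi (A : Matrix (κ × Fin 2) (κ × Fin 2) R) (p : ℕ) :
    Stab (osum A (psi (Fin p) R)) A :=
  ⟨0, p + 0, (osum_psi_psi A p 0).symm⟩

theorem psi_stab (p q : ℕ) : Stab (psi (Fin p) R) (psi (Fin q) R) := by
  refine ⟨q, p, (Iso.osum_comm _ _)⟩

end Sum

section Group
variable {R : Type*} [CommRing R]

theorem perp_iso {m n : ℕ} (G : Matrix (Idx m) (Idx m) R) (H : Matrix (Idx n) (Idx n) R) :
    Iso (perp G H) (osum G H) :=
  Iso.rx finSumFinEquiv.symm _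

theorem stableCongr_iff {n m : ℕ} (G : Matrix (Idx n) (Idx n) R) (G' : Matrix (Idx m) (Idx m) R) :
    StableCongr G G' ↔ Stab G G' := by
  constructor
  · rintro ⟨t, E, hE, h⟩
    refine ⟨m + t, n + t, (perp_iso _ _).symm.trans (Iso.trans ?_ (perp_iso _ _))⟩
    exact Iso.trans (ElemCongr.iso ⟨E, hE, h⟩) (Iso.rx (finCongr (Nat.add_left_comm n m t)) _)
  · rintro ⟨p, q, h⟩
    have hc : n + p = m + q := by
      obtain ⟨e, -⟩ := h
      simpa using Fintype.card_congr e
    have key : Iso (osum G (psi (Fin (m + p)) R)) (osum G' (psi (Fin (n + p)) R)) := by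
      have h1 : m + p = p + m := by omega
      have h2 : n + p = q + m := by omega
      rw [h1, h2]
      exact (osum_psi_psi G p m).trans ((h.osum_left _).trans (osum_psi_psi G' q m).symm)
    refine ⟨p, ?_⟩
    exact ((perp_iso _ _).trans (key.trans ((perp_iso _ _).symm.trans
      (Iso.rx (finCongr (Nat.add_left_comm n m p)) _).symm))).congr

theorem IsAlternating.submatrix {ι κ : Type} {G : Matrix ι ι R} (h : IsAlternating G)
    (f : κ → ι) : IsAlternating (G.submatrix f f) := by
  refine ⟨?_, fun i => h.2 _⟩
  rw [transpose_submatrix, h.1]; rfl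

theorem IsAlternating.fromBlocks {ι κ : Type} {G : Matrix ι ι R} {H : Matrix κ κ R}
    (h : IsAlternating G) (h' : IsAlternating H) :
    IsAlternating (Matrix.fromBlocks G 0 0 H) := by
  refine ⟨?_, ?_⟩
  · rw [fromBlocks_transpose, h.1, h'.1, fromBlocks_neg]; simp
  · rintro (i | i)
    · exact h.2 i
    · exact h'.2 i

theorem IsAlternating.perp {m n : ℕ} {G : Matrix (Idx m) (Idx m) R} {H : Matrix (Idx n) (Idx n) R}
    (h : IsAlternating G) (h' : IsAlternating H) : IsAlternating (perp G H) :=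
  ((h.fromBlocks h').submatrix _).submatrix _

theorem isUnit_perp {m n : ℕ} {G : Matrix (Idx m) (Idx m) R} {H : Matrix (Idx n) (Idx n) R}
    (h : IsUnit G) (h' : IsUnit H) : IsUnit (perp G H) := by
  rw [Matrix.isUnit_iff_isUnit_det] at *
  have e : perp G H = (Matrix.fromBlocks G 0 0 H).submatrix
      ((finSumFinEquiv.symm.prodCongr (Equiv.refl _)).trans (Equiv.sumProdDistrib _ _ (Fin 2)))
      ((finSumFinEquiv.symm.prodCongr (Equiv.refl _)).trans (Equiv.sumProdDistrib _ _ (Fin 2))) :=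
    rfl
  rw [e, det_submatrix_equiv_self, det_fromBlocks_zero₂₁]
  exact h.mul h'

theorem pfaffian_perp {m n : ℕ} (G : Matrix (Idx m) (Idx m) R) (H : Matrix (Idx n) (Idx n) R) :
    pfaffian (perp G H) = pfaffian G * pfaffian H := by
  have hs : (m + n) * 2 = m * 2 + n * 2 := by omega
  have hl : ∀ x : Fin (m * 2), finProdFinEquiv.symm (Fin.cast hs.symm (Fin.castAdd (n * 2) x)) =
      (Fin.castAdd n (finProdFinEquiv.symm x).1, (finProdFinEquiv.symm x).2) := by
    intro x
    rw [Equiv.symm_apply_eq]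
    ext
    simp [finProdFinEquiv, Nat.mod_add_div]
  have hr : ∀ x : Fin (n * 2), finProdFinEquiv.symm (Fin.cast hs.symm (Fin.natAdd (m * 2) x)) =
      (Fin.natAdd m (finProdFinEquiv.symm x).1, (finProdFinEquiv.symm x).2) := by
    intro x
    rw [Equiv.symm_apply_eq]
    ext
    simp [finProdFinEquiv]
    omega
  rw [pfaffian, pf_block (m * 2) (n * 2) ((m + n) * 2) hs]
  · congr 1
    · congr 1
      ext x y
      simp only [Matrix.submatrix_apply, hl]
      simp [perp, rx, osum]
    · congr 1
      ext x y
      simp only [Matrix.submatrix_apply, hr]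
      simp [perp, rx, osum]
  · intro i j hi hj
    obtain ⟨i, rfl⟩ : ∃ x, i = Fin.cast hs.symm (Fin.castAdd (n * 2) x) := ⟨⟨i, hi⟩, rfl⟩
    obtain ⟨j, rfl⟩ : ∃ x, j = Fin.cast hs.symm (Fin.natAdd (m * 2) x) :=
      ⟨⟨j - m * 2, by omega⟩, by ext; simp; omega⟩
    simp only [Matrix.submatrix_apply, hl, hr]
    simp [perp, rx, osum]

theorem pfaffian_congr {n : ℕ} {A B : Matrix (Idx n) (Idx n) R} (hB : IsAlternating B)
    (h : ElemCongr A B) : pfaffian A = pfaffian B := by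
  obtain ⟨E, hE, h⟩ := h.submatrix (finProdFinEquiv (m := n) (n := 2)).symm
  have h1 := hB.submatrix (finProdFinEquiv (m := n) (n := 2)).symm
  rw [pfaffian, h, pf_congr _ _ h1.1 h1.2, elementary_det hE, one_mul, pfaffian]

theorem pfaffian_cast {k n : ℕ} (h : k = n) (A : Matrix (Idx n) (Idx n) R) :
    pfaffian (rx (Fin.cast h) A) = pfaffian A := by
  subst h; rfl

theorem psi_alt (κ : Type) [DecidableEq κ] : IsAlternating (psi κ R) := by
  refine ⟨?_, ?_⟩
  · ext ⟨i, a⟩ ⟨j, b⟩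
    by_cases h : i = j
    · subst h
      fin_cases a <;> fin_cases b <;> simp [psi]
    · simp [psi, h, Ne.symm h]
  · rintro ⟨i, a⟩
    fin_cases a <;> simp [psi]

theorem psi_perp (m n : ℕ) : perp (psi (Fin m) R) (psi (Fin n) R) = psi (Fin (m + n)) R := by
  rw [perp, osum_psi, rx_psi]

theorem pfaffian_psi (n : ℕ) : pfaffian (psi (Fin n) R) = 1 := by
  induction n with
  | zero => simp [pfaffian, pf]
  | succ n ih =>
    rw [← psi_perp, pfaffian_perp, ih, one_mul]
    simp [pfaffian, pf, psi, finProdFinEquiv, Fin.divNat, Fin.modNat]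

theorem psi_mul_neg (n : ℕ) : psi (Fin n) R * -psi (Fin n) R = 1 := by
  rw [mul_neg, psi, ← Matrix.mul_kronecker_mul, ← Matrix.one_kronecker_one]
  ext ⟨i, a⟩ ⟨j, b⟩
  fin_cases a <;> fin_cases b <;> simp

theorem sigma_transpose (n : ℕ) : (sigma n R)ᵀ = sigma n R := by
  ext ⟨i, a⟩ ⟨j, b⟩
  by_cases h : i = j
  · subst h
    fin_cases a <;> fin_cases b <;> simp [sigma]
  · simp [sigma, h, Ne.symm h]

theorem sigma_mul_self (n : ℕ) : sigma n R * sigma n R = 1 := by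
  rw [sigma, ← Matrix.mul_kronecker_mul, ← Matrix.one_kronecker_one]
  ext ⟨i, a⟩ ⟨j, b⟩
  fin_cases a <;> fin_cases b <;> simp

theorem sigma_psi_sigma (n : ℕ) : sigma n R * (psi (Fin n) R)⁻¹ * sigma n R = psi (Fin n) R := by
  rw [Matrix.inv_eq_right_inv (psi_mul_neg n), mul_neg, neg_mul, sigma, psi,
    ← Matrix.mul_kronecker_mul, ← Matrix.mul_kronecker_mul, one_mul, one_mul]
  ext ⟨i, a⟩ ⟨j, b⟩
  fin_cases a <;> fin_cases b <;> simp

theorem psi_isUnit (n : ℕ) : IsUnit (psi (Fin n) R) :=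
  (Matrix.isUnit_iff_isUnit_det _).2 (Matrix.isUnit_det_of_right_inverse (psi_mul_neg n))

theorem osum_inv_iso {n : ℕ} {G : Matrix (Idx n) (Idx n) R} (h : IsAlternating G)
    (h' : IsUnit G) :
    Iso (osum G (sigma n R * G⁻¹ * sigma n R)) (osum (psi (Fin n) R) (psi (Fin n) R)) := by
  have h1 := altBlocks_congr h.1 h.2 h' (sigma_transpose n) (sigma_mul_self n)
  have h2 := altBlocks_congr (R := R) (psi_alt (Fin n)).1 (psi_alt (Fin n)).2 (psi_isUnit n)
    (sigma_transpose n) (sigma_mul_self n)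
  rw [sigma_psi_sigma] at h2
  exact ((h1.trans h2.symm).submatrix (Equiv.sumProdDistrib (Fin n) (Fin n) (Fin 2))).iso

theorem IsAlternating.inv {n : ℕ} {G : Matrix (Idx n) (Idx n) R} (h : IsAlternating G)
    (h' : IsUnit G) : IsAlternating (sigma n R * G⁻¹ * sigma n R) := by
  have hit := inv_transpose_of_alt h.1 h'
  have hiG : G⁻¹ * G = 1 := Matrix.nonsing_inv_mul G ((Matrix.isUnit_iff_isUnit_det G).1 h')
  refine ⟨?_, fun i => ?_⟩
  · simp only [transpose_mul, sigma_transpose, hit, mul_assoc, neg_mul, mul_neg]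
  · obtain ⟨U, hU⟩ := exists_sub_transpose h.1 h.2
    obtain ⟨X, hX⟩ : ∃ X, X = G⁻¹ * sigma n R := ⟨_, rfl⟩
    have hXt : Xᵀ = -(sigma n R * G⁻¹) := by
      rw [hX, transpose_mul, sigma_transpose, hit, mul_neg]
    have e : sigma n R * G⁻¹ * sigma n R = (Xᵀ * U * X)ᵀ - Xᵀ * U * X := by
      calc sigma n R * G⁻¹ * sigma n R = -(Xᵀ * G * X) := by
            rw [hXt, neg_mul, neg_mul, neg_neg, mul_assoc _ G⁻¹ G, hiG, mul_one, mul_assoc, hX]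
        _ = Xᵀ * Uᵀ * X - Xᵀ * U * X := by
            rw [hU, mul_sub, sub_mul, neg_sub]
        _ = _ := by rw [transpose_mul, transpose_mul, transpose_transpose, mul_assoc]
    rw [e, Matrix.sub_apply, Matrix.transpose_apply, sub_self]

theorem pfaffian_inv {n : ℕ} {G : Matrix (Idx n) (Idx n) R} (h : IsAlternating G)
    (h' : IsUnit G) (h1 : pfaffian G = 1) : pfaffian (sigma n R * G⁻¹ * sigma n R) = 1 := by
  have e : Iso (perp G (sigma n R * G⁻¹ * sigma n R)) (psi (Fin (n + n)) R) := by
    rw [← psi_perp]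
    exact (perp_iso _ _).trans ((osum_inv_iso h h').trans (perp_iso _ _).symm)
  have := pfaffian_congr (psi_alt _) e.congr
  rwa [pfaffian_perp, h1, one_mul, pfaffian_psi] at this

/-- The relation `∼` on `S(R)`. -/
instance AltForm.setoid (R : Type*) [CommRing R] : Setoid (AltForm R) where
  r := fun G G' => StableCongr G.mat G'.mat
  iseqv :=
    { refl := fun _ => (stableCongr_iff _ _).2 (Iso.refl _).stab
      symm := fun h => (stableCongr_iff _ _).2 ((stableCongr_iff _ _).1 h).symm
      trans := fun h h' => (stableCongr_iff _ _).2
        (((stableCongr_iff _ _).1 h).trans ((stableCongr_iff _ _).1 h')) }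

/-- The orthogonal sum on `S(R)`. -/
def AltForm.perp (G H : AltForm R) : AltForm R where
  n := G.n + H.n
  mat := SympWitt.perp G.mat H.mat
  alt := G.alt.perp H.alt
  isUnit := isUnit_perp G.isUnit H.isUnit
  pfaffian_eq := by rw [pfaffian_perp, G.pfaffian_eq, H.pfaffian_eq, one_mul]

/-- The form `σ G⁻¹ σ`, which represents the inverse of the class of `G`. -/
noncomputable def AltForm.inv (G : AltForm R) : AltForm R where
  n := G.n
  mat := sigma G.n R * G.mat⁻¹ * sigma G.n R
  alt := G.alt.inv G.isUnit
  isUnit := by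
    have hs : IsUnit (sigma G.n R) := IsUnit.of_mul_eq_one _ (sigma_mul_self G.n)
    exact (hs.mul ((Matrix.isUnit_nonsing_inv_iff).2 G.isUnit)).mul hs
  pfaffian_eq := pfaffian_inv G.alt G.isUnit G.pfaffian_eq

/-- The form `ψ_{2n}`. -/
def AltForm.psi (n : ℕ) (R : Type*) [CommRing R] : AltForm R where
  n := n
  mat := SympWitt.psi (Fin n) R
  alt := psi_alt _
  isUnit := psi_isUnit n
  pfaffian_eq := pfaffian_psi n

theorem AltForm.equiv_iff (G H : AltForm R) : G ≈ H ↔ Stab G.mat H.mat := stableCongr_iff _ _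

theorem AltForm.perp_equiv {G G' H H' : AltForm R} (h : G ≈ G') (h' : H ≈ H') :
    G.perp H ≈ G'.perp H' := by
  rw [AltForm.equiv_iff] at *
  refine (perp_iso _ _).stab.trans ((h.osum_left _).trans ?_)
  refine (Iso.osum_comm _ _).stab.trans ((h'.osum_left _).trans ?_)
  exact ((Iso.osum_comm _ _).trans (perp_iso _ _).symm).stab

theorem AltForm.perp_comm (G H : AltForm R) : G.perp H ≈ H.perp G :=
  (AltForm.equiv_iff _ _).2
    ((perp_iso _ _).trans ((Iso.osum_comm _ _).trans (perp_iso _ _).symm)).stab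

theorem AltForm.perp_assoc (G H K : AltForm R) : (G.perp H).perp K ≈ G.perp (H.perp K) :=
  (AltForm.equiv_iff _ _).2
    (((perp_iso _ _).trans ((perp_iso _ _).osum_left _)).trans ((Iso.osum_assoc _ _ _).trans
      ((perp_iso _ _).trans ((perp_iso _ _).osum_right _)).symm)).stab

theorem AltForm.perp_psi (G : AltForm R) (n : ℕ) : G.perp (AltForm.psi n R) ≈ G :=
  (AltForm.equiv_iff _ _).2 ((perp_iso _ _).stab.trans (Stab.osum_psi G.mat n))

theorem AltForm.perp_inv (G : AltForm R) : G.perp G.inv ≈ AltForm.psi 1 R := by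
  rw [AltForm.equiv_iff]
  refine Stab.trans ?_ (psi_stab (G.n + G.n) 1)
  rw [← psi_perp]
  exact ((perp_iso _ _).trans ((osum_inv_iso G.alt G.isUnit).trans (perp_iso _ _).symm)).stab

theorem AltForm.inv_equiv {G H : AltForm R} (h : G ≈ H) : G.inv ≈ H.inv := by
  have h1 : G.inv ≈ G.inv.perp (H.perp H.inv) :=
    Setoid.trans (Setoid.symm (AltForm.perp_psi G.inv 1))
      (AltForm.perp_equiv (Setoid.refl _) (Setoid.symm (AltForm.perp_inv H)))
  have h2 : (G.inv.perp H).perp H.inv ≈ H.inv :=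
    Setoid.trans (AltForm.perp_equiv
      (Setoid.trans (AltForm.perp_equiv (Setoid.refl _) (Setoid.symm h))
        (Setoid.trans (AltForm.perp_comm _ _) (AltForm.perp_inv G))) (Setoid.refl _))
      (Setoid.trans (AltForm.perp_comm _ _) (AltForm.perp_psi _ 1))
  exact Setoid.trans h1 (Setoid.trans (Setoid.symm (AltForm.perp_assoc _ _ _)) h2)

/-- The elementary symplectic Witt group `W_E(R) = S(R)/∼`. -/
def WE (R : Type*) [CommRing R] : Type _ := Quotient (AltForm.setoid R)

/-- The class in `W_E(R)` of an element of `S(R)`. -/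
def WE.mk (G : AltForm R) : WE R := Quotient.mk _ G

/-- The sum of `W_E(R)` is induced by `⊥`. -/
instance WE.instAdd (R : Type*) [CommRing R] : Add (WE R) where
  add := Quotient.map₂ AltForm.perp fun _ _ h _ _ h' => AltForm.perp_equiv h h'

/-- The neutral element of `W_E(R)` is the class of `ψ₂`. -/
instance WE.instZero (R : Type*) [CommRing R] : Zero (WE R) where
  zero := WE.mk (AltForm.psi 1 R)

/-- The inverse in `W_E(R)` is induced by `G ↦ σ G⁻¹ σ`. -/
noncomputable instance WE.instNeg (R : Type*) [CommRing R] : Neg (WE R) where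
  neg := Quotient.map AltForm.inv fun _ _ h => AltForm.inv_equiv h

/-- The abelian group `W_E(R)`. -/
noncomputable instance WE.instAddCommGroup (R : Type*) [CommRing R] : AddCommGroup (WE R) where
  nsmul := nsmulRec
  zsmul := zsmulRec
  add_assoc := by
    rintro ⟨G⟩ ⟨H⟩ ⟨K⟩
    exact Quotient.sound (AltForm.perp_assoc G H K)
  zero_add := by
    rintro ⟨G⟩
    exact Quotient.sound (Setoid.trans (AltForm.perp_comm _ _) (AltForm.perp_psi G 1))
  add_zero := by
    rintro ⟨G⟩
    exact Quotient.sound (AltForm.perp_psi G 1)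
  add_comm := by
    rintro ⟨G⟩ ⟨H⟩
    exact Quotient.sound (AltForm.perp_comm G H)
  neg_add_cancel := by
    rintro ⟨G⟩
    exact Quotient.sound (Setoid.trans (AltForm.perp_comm _ _) (AltForm.perp_inv G))

theorem WE.mk_add_mk (G H : AltForm R) : WE.mk G + WE.mk H = WE.mk (G.perp H) := rfl

theorem WE.mk_eq_mk_iff (G H : AltForm R) : WE.mk G = WE.mk H ↔ StableCongr G.mat H.mat :=
  Quotient.eq

end Group

section Vaserstein
variable {R : Type*} [CommRing R]

/-- The alternating matrix of a row `(a, b, c)` and a row `(a', b', c')`, as a `4 × 4` matrix. -/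
def vasersteinMatrix (a b c a' b' c' : R) : Matrix (Fin 4) (Fin 4) R :=
  !![0, -a, -b, -c;
     a, 0, -c', b';
     b, c', 0, -a';
     c, -b', a', 0]

theorem vasersteinMatrix_alt (a b c a' b' c' : R) :
    IsAlternating (vasersteinMatrix a b c a' b' c') := by
  refine ⟨?_, ?_⟩
  · ext i j
    fin_cases i <;> fin_cases j <;> simp [vasersteinMatrix]
  · intro i
    fin_cases i <;> simp [vasersteinMatrix]

theorem vasersteinMatrix_det (a b c a' b' c' : R) :
    (vasersteinMatrix a b c a' b' c').det = (a * a' + b * b' + c * c') ^ 2 := by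
  simp [vasersteinMatrix, Matrix.det_succ_row_zero, Fin.sum_univ_succ, Fin.succAbove]
  ring

theorem vasersteinMatrix_pf (a b c a' b' c' : R) :
    pf 4 (vasersteinMatrix a b c a' b' c') = a * a' + b * b' + c * c' := by
  simp [vasersteinMatrix, pf, Fin.sum_univ_succ, Fin.succAbove]
  ring

/-- The matrix `V(a, b, c)` attached to a row `(a, b, c)` and to a choice of `(a', b', c')` with
`a a' + b b' + c c' = 1`, as an element of `S(R)`. -/
def vasersteinForm {a b c a' b' c' : R} (h : a * a' + b * b' + c * c' = 1) : AltForm R where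
  n := 2
  mat := (vasersteinMatrix a b c a' b' c').submatrix (finProdFinEquiv (m := 2) (n := 2))
    (finProdFinEquiv (m := 2) (n := 2))
  alt := (vasersteinMatrix_alt a b c a' b' c').submatrix _
  isUnit := by
    rw [Matrix.isUnit_iff_isUnit_det]
    have := Matrix.det_submatrix_equiv_self (finProdFinEquiv (m := 2) (n := 2))
      (vasersteinMatrix a b c a' b' c')
    rw [this, vasersteinMatrix_det, h]
    simp
  pfaffian_eq := by
    have e : ((vasersteinMatrix a b c a' b' c').submatrix (finProdFinEquiv (m := 2) (n := 2))
      (finProdFinEquiv (m := 2) (n := 2))).submatrix finProdFinEquiv.symm finProdFinEquiv.symm =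
        vasersteinMatrix a b c a' b' c' := by
      ext i j
      simp
    rw [pfaffian, e]
    exact (vasersteinMatrix_pf a b c a' b' c').trans h

/-- The class of `V(a, b, c)` in `W_E(R)`, for a choice of `(a', b', c')` with
`a a' + b b' + c c' = 1`. -/
def vaserstein {a b c a' b' c' : R} (h : a * a' + b * b' + c * c' = 1) : WE R :=
  WE.mk (vasersteinForm h)

end Vaserstein

end SympWitt

namespace SympWitt

open Matrix

/-! ### Hyperbolic forms of square matrices -/

section Hyperbolic
variable {R : Type*} [CommRing R] {ι : Type} [Fintype ι] [DecidableEq ι]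

/-! Let `G` be the Vaserstein matrix of `(a, b, c)` and let `i² = -1`. If `P` is alternating and
`A`, `P` are invertible, the graph of `A` is a Lagrangian in `AᵗPA ⊥ -P`, so this form is
elementarily congruent to the hyperbolic form of `-AᵗP` (`congr_neg_hyperbolic`). The hyperbolic
form of `Q` depends, up to elementary congruence, only on the double coset of `Q` modulo elementary
matrices (`hyperbolic_congr`).

This is used twice. With `P = -G` and `A = i` it turns `G ⊥ G` into the hyperbolic form of `iG`,
because `i · (-G) · i = G`. With `P = -ψ₄` and `A = EGF`, for `E`, `F` elementary, it turns
`Aᵗ(-ψ₄)A ⊥ ψ₄` into the hyperbolic form of `Aᵗψ₄ = -FᵗGEᵗψ₄`. Since `i` (as a scalar matrix) and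
`ψ₄` are elementary in size 4, the two hyperbolic forms agree, whence `Aᵗ(-ψ₄)A ⊥ ψ₄ ≅ G ⊥ G`
(`fromBlocks_congr_fromBlocks_self`).

It remains to choose `E` and `F` so that `Aᵗ(-ψ₄)A` is a Vaserstein matrix of `(a², b, c)`. Its
first row is the first row of `A` as soon as the first column of `A` is the second basis vector, and
`exists_completion_sq` makes that row `(0, -a², -b, -c)`. Independence of the choice of `(a', b',
c')` is `vasersteinMatrix_congr`. -/

theorem elementary_transpose {E : Matrix ι ι R} (hE : E ∈ elementary ι R) :
    Eᵀ ∈ elementary ι R := by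
  induction hE using Submonoid.closure_induction with
  | mem x hx =>
    obtain ⟨i, j, h, c, rfl⟩ := hx
    have : (transvection i j c)ᵀ = transvection j i c := by
      simp [transvection, transpose_single]
    rw [this]
    exact transvection_mem h.symm c
  | one => simp [one_mem]
  | mul x y _ _ hx hy => rw [transpose_mul]; exact mul_mem hy hx

/-- The hyperbolic form of a square matrix. -/
def hyperbolic (Q : Matrix ι ι R) : Matrix (ι ⊕ ι) (ι ⊕ ι) R := fromBlocks 0 Q (-Qᵀ) 0

/-- The bases of the two Lagrangian halves can be changed independently, by `Eᵗ` and by `F`. -/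
theorem hyperbolic_congr (Q : Matrix ι ι R) {E F : Matrix ι ι R} (hE : E ∈ elementary ι R)
    (hF : F ∈ elementary ι R) : ElemCongr (hyperbolic (E * Q * F)) (hyperbolic Q) := by
  have hF' : fromBlocks 1 0 0 F ∈ elementary (ι ⊕ ι) R := by
    convert elementary_submatrix (Equiv.sumComm ι ι) (elementary_sumInl (κ := ι) hF) using 1
    ext (a | a) (b | b) <;> simp
  refine ⟨_, mul_mem (elementary_sumInl (elementary_transpose hE)) hF', ?_⟩
  simp [hyperbolic, fromBlocks_transpose, fromBlocks_multiply, mul_assoc]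

/-- A form with a Lagrangian given by half of the basis is hyperbolic. -/
theorem hyperbolic_congr_fromBlocks {Q S : Matrix ι ι R} (hQ : IsUnit Q) (hS : IsAlternating S) :
    ElemCongr (fromBlocks 0 Q (-Qᵀ) S) (hyperbolic Q) := by
  obtain ⟨U, hU⟩ := exists_sub_transpose hS.1 hS.2
  have hQi : Q⁻¹ * Q = 1 := Matrix.nonsing_inv_mul Q ((Matrix.isUnit_iff_isUnit_det Q).1 hQ)
  -- With `X = (UQ⁻¹)ᵗ`, adding multiples of the Lagrangian half to the other half creates the block
  -- `XᵗQ - QᵗX = U - Uᵗ = S`.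
  refine ⟨_, elementary_upper (U * Q⁻¹)ᵀ, ?_⟩
  have h1 : U * Q⁻¹ * Q = U := by rw [mul_assoc, hQi, mul_one]
  have h2 : Qᵀ * (U * Q⁻¹)ᵀ = Uᵀ := by rw [← transpose_mul, h1]
  rw [hyperbolic, fromBlocks_transpose, fromBlocks_multiply, fromBlocks_multiply]
  simp only [transpose_one, transpose_zero, transpose_transpose, one_mul, mul_one, zero_mul,
    mul_zero, add_zero, zero_add, neg_mul, h1, h2]
  rw [hU, neg_add_eq_sub]

/-- `A` is an isometry from `AᵗPA` to `P`, so its graph is totally isotropic in `AᵗPA ⊥ -P`. Taking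
the graph as the first half of the basis kills the upper left block. -/
theorem congr_neg_hyperbolic {P A : Matrix ι ι R} (hP : IsAlternating P) (hPu : IsUnit P)
    (hA : IsUnit A) :
    ElemCongr (fromBlocks (Aᵀ * P * A) 0 0 (-P)) (hyperbolic (-(Aᵀ * P))) := by
  have hPn : IsAlternating (-P) := ⟨by rw [transpose_neg, hP.1], fun i => by simp [hP.2]⟩
  have hQ : IsUnit (-(Aᵀ * P)) := by
    have : IsUnit Aᵀ := by
      rw [Matrix.isUnit_iff_isUnit_det, det_transpose, ← Matrix.isUnit_iff_isUnit_det]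
      exact hA
    exact (this.mul hPu).neg
  refine ElemCongr.trans (ElemCongr.symm ?_) (hyperbolic_congr_fromBlocks hQ hPn)
  refine ⟨_, elementary_lower A, ?_⟩
  simp [fromBlocks_transpose, fromBlocks_multiply, hP.1, mul_assoc]

theorem isUnit_of_mem_elementary {E : Matrix ι ι R} (hE : E ∈ elementary ι R) : IsUnit E := by
  rw [Matrix.isUnit_iff_isUnit_det, elementary_det hE]
  exact isUnit_one

theorem IsAlternating.neg {κ : Type} {P : Matrix κ κ R} (hP : IsAlternating P) : IsAlternating (-P) :=
  ⟨by rw [transpose_neg, hP.1], fun i => by simp [hP.2]⟩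

/-- Both sides are hyperbolic by `congr_neg_hyperbolic`, on matrices in the same double coset modulo
elementary matrices. The root of `-1` enters twice: it makes `-G` congruent to `G`, and it absorbs
the sign in `Gᵗ = -G`. -/
theorem fromBlocks_congr_fromBlocks_self {P G E F : Matrix ι ι R} (hP : IsAlternating P)
    (hPe : P ∈ elementary ι R) (hG : IsAlternating G) (hGu : IsUnit G) {i : R} (hi : i * i = -1)
    (hs : i • (1 : Matrix ι ι R) ∈ elementary ι R) (hE : E ∈ elementary ι R)
    (hF : F ∈ elementary ι R) :
    ElemCongr (fromBlocks ((E * G * F)ᵀ * -P * (E * G * F)) 0 0 P) (fromBlocks G 0 0 G) := by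
  have s1 := congr_neg_hyperbolic (A := E * G * F) hP.neg (isUnit_of_mem_elementary hPe).neg
    (((isUnit_of_mem_elementary hE).mul hGu).mul (isUnit_of_mem_elementary hF))
  have s2 := congr_neg_hyperbolic hG.neg hGu.neg (isUnit_of_mem_elementary hs)
  have e2 : (i • (1 : Matrix ι ι R))ᵀ * -G * i • (1 : Matrix ι ι R) = G := by
    simp [smul_smul, hi]
  rw [neg_neg] at s1 s2
  rw [e2] at s2
  refine (s1.trans ?_).trans s2.symm
  -- The matrices to compare are `(EGF)ᵗP = -FᵗGEᵗP` and `iG`; they are related by `-FᵗGEᵗP = Fᵗ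
  -- (iG) (iEᵗP)`.
  convert hyperbolic_congr _ (elementary_transpose hF)
    (mul_mem hs (mul_mem (elementary_transpose hE) hPe)) using 2
  simp [transpose_mul, hG.1, mul_assoc, smul_smul, hi]

end Hyperbolic

/-! ### Elementary matrices of size 4 -/

section FourByFour
variable {R : Type*} [CommRing R]

/-- Whitehead's identity `diag(u, u⁻¹) = w(u) w(-1)`, where `w(u) = e₀₁(u) e₁₀(-u⁻¹) e₀₁(u)`. -/
theorem diagonal_mem_elementary {u v : R} (h : u * v = 1) :
    diagonal ![u, v, 1, 1] ∈ elementary (Fin 4) R := by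
  have h01 : (0 : Fin 4) ≠ 1 := by decide
  convert mul_mem (mul_mem (mul_mem (transvection_mem h01 u) (transvection_mem h01.symm (-v)))
      (transvection_mem h01 u)) (mul_mem (mul_mem (transvection_mem h01 (-1))
      (transvection_mem h01.symm 1)) (transvection_mem h01 (-1))) using 1
  ext x y
  fin_cases x <;> fin_cases y <;>
    simp [transvection, Matrix.mul_apply, Fin.sum_univ_four, Matrix.one_apply,
      Matrix.single_apply] <;>
    first
      | ring1
      | linear_combination h
      | linear_combination -h
      | linear_combination u * h
      | linear_combination -u * h

/-- The scalar `i` has determinant `i⁴ = 1` and factors as `diag(i, -i, 1, 1) · diag(1, -1, -1, 1) ·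
diag(1, 1, -i, i)`. -/
theorem scalar_mem_elementary {i : R} (hi : i * i = -1) :
    i • (1 : Matrix (Fin 4) (Fin 4) R) ∈ elementary (Fin 4) R := by
  have h1 := diagonal_mem_elementary (R := R) (u := i) (v := -i) (by linear_combination -hi)
  have h2 := elementary_submatrix (Equiv.swap (0 : Fin 4) 2)
    (diagonal_mem_elementary (R := R) (u := -1) (v := -1) (by ring))
  have h3 := elementary_submatrix ((Equiv.swap (0 : Fin 4) 2).trans (Equiv.swap 1 3))
    (diagonal_mem_elementary (R := R) (u := -i) (v := i) (by linear_combination -hi))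
  convert mul_mem h1 (mul_mem h2 h3) using 1
  rw [submatrix_diagonal_equiv, submatrix_diagonal_equiv, diagonal_mul_diagonal,
    diagonal_mul_diagonal, smul_one_eq_diagonal]
  congr 1
  funext x
  fin_cases x <;> simp [Equiv.swap_apply_def]

/-- The matrix `ψ₄`. -/
def psiFour (R : Type*) [CommRing R] : Matrix (Fin 4) (Fin 4) R :=
  !![0, 1, 0, 0; -1, 0, 0, 0; 0, 0, 0, 1; 0, 0, -1, 0]

theorem psiFour_submatrix :
    (psiFour R).submatrix (finProdFinEquiv (m := 2) (n := 2)) (finProdFinEquiv (m := 2) (n := 2)) =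
      psi (Fin 2) R := by
  ext ⟨i, a⟩ ⟨j, b⟩
  fin_cases i <;> fin_cases j <;> fin_cases a <;> fin_cases b <;>
    simp [psiFour, psi, finProdFinEquiv]

theorem psiFour_mem : psiFour R ∈ elementary (Fin 4) R := by
  have h01 : (0 : Fin 4) ≠ 1 := by decide
  have h23 : (2 : Fin 4) ≠ 3 := by decide
  convert mul_mem (signedSwap_mem (R := R) h01) (mul_mem (signedSwap_mem (R := R) h23)
    (one_mem _)) using 1
  ext x y
  rw [signedSwap_mul h01]
  simp only [signedSwap_mul h23]
  fin_cases x <;> fin_cases y <;> simp [psiFour, Matrix.one_apply]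

theorem psiFour_alt : IsAlternating (psiFour R) := by
  refine ⟨?_, fun i => ?_⟩
  · ext i j
    fin_cases i <;> fin_cases j <;> simp [psiFour]
  · fin_cases i <;> simp [psiFour]

/-- The Pfaffian has degree 2 in size 4, so the sign does not change it. -/
theorem pf_neg_psiFour : pf 4 (-psiFour R) = 1 := by
  simp [psiFour, pf, Fin.sum_univ_succ, Fin.succAbove]

theorem rowOp_zero_mem (p q r : R) :
    !![1, p, q, r; 0, 1, 0, 0; 0, 0, 1, 0; 0, 0, 0, 1] ∈ elementary (Fin 4) R := by
  convert mul_mem (transvection_mem (R := R) (show (0 : Fin 4) ≠ 1 by decide) p)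
    (mul_mem (transvection_mem (show (0 : Fin 4) ≠ 2 by decide) q)
      (transvection_mem (show (0 : Fin 4) ≠ 3 by decide) r)) using 1
  ext x y
  fin_cases x <;> fin_cases y <;>
    simp [transvection, Matrix.mul_apply, Fin.sum_univ_four, Matrix.one_apply, Matrix.single_apply]

theorem rowOp_one_mem (p q r : R) :
    !![1, 0, 0, 0; p, 1, q, r; 0, 0, 1, 0; 0, 0, 0, 1] ∈ elementary (Fin 4) R := by
  convert elementary_submatrix (Equiv.swap 0 1) (rowOp_zero_mem p q r) using 1
  ext x y
  fin_cases x <;> fin_cases y <;> simp [Equiv.swap_apply_def]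

theorem colOp_one_mem (p q r : R) :
    !![1, p, 0, 0; 0, 1, 0, 0; 0, q, 1, 0; 0, r, 0, 1] ∈ elementary (Fin 4) R := by
  convert elementary_transpose (rowOp_one_mem p q r) using 1
  ext x y
  fin_cases x <;> fin_cases y <;> simp

/-- The transvection `1 - x N` with `N = (y, z)ᵗ (z, -y)`, so that `N² = 0`. -/
theorem nilpotentTransvection_mem (x y z : R) :
    !![1, 0, 0, 0; 0, 1, 0, 0; 0, 0, 1 - x * (y * z), x * y ^ 2;
      0, 0, -(x * z ^ 2), 1 + x * (y * z)] ∈ elementary (Fin 4) R := by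
  -- This is the commutator of `1 + e₁ρ` and `1 + γe₁ᵗ`, with `ρ = (-z, y)` and `γ = -x (y, z)ᵗ` in
  -- the last two coordinates. As `ργ = 0`, it equals `1 - γρ = 1 - xN`.
  convert mul_mem (mul_mem (rowOp_one_mem 0 (-z) y) (colOp_one_mem 0 (-(x * y)) (-(x * z))))
    (mul_mem (rowOp_one_mem 0 z (-y)) (colOp_one_mem 0 (x * y) (x * z))) using 1
  ext i j
  fin_cases i <;> fin_cases j <;> simp [Matrix.mul_apply, Fin.sum_univ_four] <;> ring

/-! ### Vaserstein matrices and the passage from `a` to `a²` -/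

/-- The class of the Vaserstein matrix does not depend on the choice of `(a', b', c')`. -/
theorem vasersteinMatrix_congr {a b c a₁ b₁ c₁ a₂ b₂ c₂ : R}
    (h₁ : a * a₁ + b * b₁ + c * c₁ = 1) (h₂ : a * a₂ + b * b₂ + c * c₂ = 1) :
    ElemCongr (vasersteinMatrix a b c a₁ b₁ c₁) (vasersteinMatrix a b c a₂ b₂ c₂) := by
  -- The coefficients are the cross product `v₂ × v₁` of the two choices. For `v = (a, b, c)`, the
  -- identity `v × (v₁ × v₂) = (v·v₂) v₁ - (v·v₁) v₂ = v₁ - v₂` shows that it changes one choice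
  -- into the other.
  refine ⟨_, rowOp_zero_mem (b₂ * c₁ - b₁ * c₂) (c₂ * a₁ - c₁ * a₂) (a₂ * b₁ - a₁ * b₂), ?_⟩
  ext i j
  fin_cases i <;> fin_cases j <;>
    simp [vasersteinMatrix, Matrix.mul_apply, Fin.sum_univ_four] <;>
    first
      | ring1
      | linear_combination a₁ * h₂ - a₂ * h₁
      | linear_combination b₁ * h₂ - b₂ * h₁
      | linear_combination c₁ * h₂ - c₂ * h₁
      | linear_combination a₂ * h₁ - a₁ * h₂
      | linear_combination b₂ * h₁ - b₁ * h₂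
      | linear_combination c₂ * h₁ - c₁ * h₂

/-- Up to elementary matrices, the Vaserstein matrix of `(a, b, c)` is the sum of a `1 × 1` block
and of a completion of the row `(a², b, c)`. -/
theorem exists_completion_sq {a b c a₁ b₁ c₁ : R} (h : a * a₁ + b * b₁ + c * c₁ = 1) :
    ∃ E ∈ elementary (Fin 4) R, ∃ F ∈ elementary (Fin 4) R,
      ((E * vasersteinMatrix a b c a₁ b₁ c₁ * F) 0 = ![0, -a ^ 2, -b, -c]) ∧
      ∀ i, (E * vasersteinMatrix a b c a₁ b₁ c₁ * F) i 0 = Pi.single (M := fun _ => R) 1 1 i := by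
  have e10 : (1 : Fin 4) ≠ 0 := by decide
  have hW : !![0, -1, 0, 0; 1, 0, 0, 0; 0, 0, 1, 0; 0, 0, 0, 1] ∈ elementary (Fin 4) R := by
    convert mul_mem (signedSwap_mem (R := R) e10) (one_mem _) using 1
    ext x y
    rw [signedSwap_mul e10]
    fin_cases x <;> fin_cases y <;> simp [Matrix.one_apply]
  -- Counting from 0, `hC` is a column operation that turns column 1 into `(-a, 1, c₁, -b₁)`, the
  -- entry 1 being the unimodularity relation. Then `hL` clears the rest of this column; adding `a`
  -- times row 1, which starts with `a`, to row 0 is what produces `a²`.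
  have hL := colOp_one_mem a (-c₁) b₁
  -- With `s = b b₁ + c c₁ = 1 - a a₁`, the operation `hS` brings the end of row 0 to `(-b, -c) - a
  -- s (c₁, -b₁)`, and `hN` then restores `(-b, -c)`. Finally `hW` interchanges the first two
  -- columns up to sign.
  have hC := colOp_one_mem a₁ (-c) b
  have hS := rowOp_zero_mem 0 (a₁ * c₁) (-(a₁ * b₁))
  have hN := nilpotentTransvection_mem a b₁ c₁
  refine ⟨_, hL, _, mul_mem hC (mul_mem hS (mul_mem hN hW)), ?_⟩
  · have key : !![1, a, 0, 0; 0, 1, 0, 0; 0, -c₁, 1, 0; 0, b₁, 0, 1] *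
        vasersteinMatrix a b c a₁ b₁ c₁ *
        !![1, a₁, 0, 0; 0, 1, 0, 0; 0, -c, 1, 0; 0, b, 0, 1] =
        !![a ^ 2, 0, -b - a * c₁, -c + a * b₁; a, 1, -c₁, b₁;
          b - a * c₁, 0, c₁ ^ 2, -a₁ - b₁ * c₁; c + a * b₁, 0, a₁ - b₁ * c₁, b₁ ^ 2] := by
      ext i j
      fin_cases i <;> fin_cases j <;>
        simp [vasersteinMatrix, Matrix.mul_apply, Fin.sum_univ_four] <;>
        first
          | ring1
          | linear_combination h
          | linear_combination a * h
          | linear_combination -c₁ * h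
          | linear_combination b₁ * h
    rw [← mul_assoc, key]
    refine ⟨?_, ?_⟩
    · funext j
      fin_cases j <;> simp [Matrix.mul_apply, Fin.sum_univ_four] <;>
        first
          | ring1
          | linear_combination a * c₁ * h
          | linear_combination -a * b₁ * h
    · intro j
      fin_cases j <;> simp [Matrix.mul_apply, Fin.sum_univ_four]

/-- An alternating matrix of size 4 has six free entries: three lie in the first row, and the other
three serve as `a'`, `b'`, `c'` up to sign. -/
theorem exists_eq_vasersteinMatrix {G : Matrix (Fin 4) (Fin 4) R} (hG : IsAlternating G)
    {a b c : R} (h : G 0 = ![0, -a, -b, -c]) :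
    G = vasersteinMatrix a b c (-G 2 3) (G 1 3) (-G 1 2) := by
  have hs : ∀ i j, G j i = -G i j := fun i j => congrFun (congrFun hG.1 i) j
  ext i j
  fin_cases i <;> fin_cases j <;>
    simp [vasersteinMatrix, hG.2, h, hs 0 1, hs 0 2, hs 0 3, hs 1 2, hs 1 3, hs 2 3]

theorem osum_submatrix {ι κ : Type} (e : κ × Fin 2 ≃ ι) (G H : Matrix ι ι R) :
    osum (G.submatrix e e) (H.submatrix e e) = (fromBlocks G 0 0 H).submatrix
      ((Equiv.sumProdDistrib κ κ (Fin 2)).trans (Equiv.sumCongr e e))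
      ((Equiv.sumProdDistrib κ κ (Fin 2)).trans (Equiv.sumCongr e e)) := by
  ext ⟨x | x, i⟩ ⟨y | y, j⟩ <;> simp [osum]

/-- The completion found above is used as the change of basis applied to `-ψ₄`. Its determinant is
1, so the Pfaffian of the resulting form is 1, which is exactly the relation required of `(a₂, b₂,
c₂)`. -/
theorem exists_congr_vasersteinMatrix_sq {a b c a₁ b₁ c₁ : R}
    (h : a * a₁ + b * b₁ + c * c₁ = 1) :
    ∃ E ∈ elementary (Fin 4) R, ∃ F ∈ elementary (Fin 4) R, ∃ a₂ b₂ c₂ : R,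
      a ^ 2 * a₂ + b * b₂ + c * c₂ = 1 ∧
      (E * vasersteinMatrix a b c a₁ b₁ c₁ * F)ᵀ * -psiFour R *
        (E * vasersteinMatrix a b c a₁ b₁ c₁ * F) = vasersteinMatrix (a ^ 2) b c a₂ b₂ c₂ := by
  obtain ⟨E, hE, F, hF, hrow, hcol⟩ := exists_completion_sq h
  have hdet : (E * vasersteinMatrix a b c a₁ b₁ c₁ * F).det = 1 := by
    rw [det_mul, det_mul, elementary_det hE, elementary_det hF, vasersteinMatrix_det, h]
    ring
  refine ⟨E, hE, F, hF, ?_⟩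
  generalize E * vasersteinMatrix a b c a₁ b₁ c₁ * F = A at *
  have hψ := psiFour_alt (R := R)
  have hpf := pf_congr (-psiFour R) A (by rw [transpose_neg, hψ.1]) (fun i => by simp [hψ.2])
  have halt : IsAlternating (Aᵀ * -psiFour R * A) := by
    -- Writing the form as a difference of a matrix and its transpose gives the zero diagonal even
    -- when 2 is not invertible.
    obtain ⟨U, hU⟩ := exists_sub_transpose hψ.1 hψ.2
    have e : Aᵀ * -psiFour R * A = (Aᵀ * U * A)ᵀ - Aᵀ * U * A := by
      rw [hU, neg_sub, mul_sub, sub_mul]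
      simp only [transpose_mul, transpose_transpose, mul_assoc]
    rw [e]
    exact ⟨by rw [transpose_sub, transpose_transpose, neg_sub],
      fun i => by rw [Matrix.sub_apply, transpose_apply, sub_self]⟩
  have hrow' : (Aᵀ * -psiFour R * A) 0 = ![0, -a ^ 2, -b, -c] := by
    -- Column 0 of `A` is the basis vector `e₁`, and row 1 of `-ψ₄` is `e₀ᵗ`; hence row 0 of the
    -- product is row 0 of `A`.
    rw [← hrow]
    funext j
    simp [Matrix.mul_apply, Fin.sum_univ_four, hcol, psiFour]
  have heq := exists_eq_vasersteinMatrix halt hrow'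
  refine ⟨_, _, _, ?_, heq⟩
  rw [← vasersteinMatrix_pf, ← heq, hpf, hdet, pf_neg_psiFour, one_mul]

theorem vasersteinMatrix_isUnit {a b c a₁ b₁ c₁ : R} (h : a * a₁ + b * b₁ + c * c₁ = 1) :
    IsUnit (vasersteinMatrix a b c a₁ b₁ c₁) := by
  rw [Matrix.isUnit_iff_isUnit_det, vasersteinMatrix_det, h]
  simp

theorem fromBlocks_vasersteinMatrix_congr (hR : IsSquare (-1 : R)) {a b c a₁ b₁ c₁ a₂ b₂ c₂ : R}
    (h₁ : a * a₁ + b * b₁ + c * c₁ = 1) (h₂ : a ^ 2 * a₂ + b * b₂ + c * c₂ = 1) :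
    ElemCongr (fromBlocks (vasersteinMatrix (a ^ 2) b c a₂ b₂ c₂) 0 0 (psiFour R))
      (fromBlocks (vasersteinMatrix a b c a₁ b₁ c₁) 0 0 (vasersteinMatrix a b c a₁ b₁ c₁)) := by
  obtain ⟨i, hi⟩ := hR
  obtain ⟨E, hE, F, hF, a₃, b₃, c₃, h₃, h⟩ := exists_congr_vasersteinMatrix_sq h₁
  refine ((vasersteinMatrix_congr h₂ h₃).fromBlocks _).trans ?_
  rw [← h]
  exact fromBlocks_congr_fromBlocks_self psiFour_alt psiFour_mem
    (vasersteinMatrix_alt a b c a₁ b₁ c₁) (vasersteinMatrix_isUnit h₁) hi.symm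
    (scalar_mem_elementary hi.symm) hE hF

end FourByFour

end SympWitt

/-! ### The relation in the elementary symplectic Witt group -/

theorem lemma4p1 {R : Type*} [CommRing R] (hR : IsSquare (-1 : R)) {a b c : R}
    {a₁ b₁ c₁ : R} (h₁ : a * a₁ + b * b₁ + c * c₁ = 1) :
    (∃ a₂ b₂ c₂ : R, a ^ 2 * a₂ + b * b₂ + c * c₂ = 1) ∧
      ∀ {a₂ b₂ c₂ : R} (h₂ : a ^ 2 * a₂ + b * b₂ + c * c₂ = 1),
        SympWitt.vaserstein h₂ = 2 • SympWitt.vaserstein h₁ := by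
  -- The witnesses come from expanding the square of `a a₁ + (b b₁ + c c₁) = 1`.
  refine ⟨⟨a₁ ^ 2, b₁ * (2 * (a * a₁) + b * b₁ + c * c₁), c₁ * (2 * (a * a₁) + b * b₁ + c * c₁),
    by linear_combination (a * a₁ + b * b₁ + c * c₁ + 1) * h₁⟩, fun {a₂ b₂ c₂} h₂ => ?_⟩
  rw [two_nsmul, SympWitt.vaserstein, SympWitt.vaserstein, SympWitt.WE.mk_add_mk,
    SympWitt.WE.mk_eq_mk_iff, SympWitt.stableCongr_iff]
  -- Adding `ψ₄` to the left side does not change its class and brings both forms to size 8, where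
  -- they are elementarily congruent.
  refine (SympWitt.Stab.osum_psi _ 2).symm.trans
    (SympWitt.Iso.stab (SympWitt.Iso.trans (SympWitt.ElemCongr.iso ?_)
      (SympWitt.perp_iso _ _).symm))
  have key := (SympWitt.fromBlocks_vasersteinMatrix_congr hR h₁ h₂).submatrix
    ((Equiv.sumProdDistrib (Fin 2) (Fin 2) (Fin 2)).trans
      (Equiv.sumCongr (finProdFinEquiv (m := 2) (n := 2)) (finProdFinEquiv (m := 2) (n := 2))))
  rw [← SympWitt.psiFour_submatrix]
  rw [← SympWitt.osum_submatrix, ← SympWitt.osum_submatrix] at key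
  exact key
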